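/- For a locally finite groupoid $\mathcal G$ (all hom-sets finite), its groupoid cardinality is $|\mathcal G|=\sum_{[x]}\frac{1}{\#\mathrm{Aut}(x)}\in[0,\infty]$, the sum running over the isomorphism classes of objects of $\mathcal G$. Let $\mathcal B$ be a groupoid. A functor $F:\mathcal G\to\mathcal B$ from a groupoid $\mathcal G$ is called relatively finite if for every object $y$ of $\mathcal B$ the full subgroupoid $F^{-1}(y)$ of $\mathcal G$ on the objects $x$ with $F(x)\cong y$ is equivalent to a finite groupoid (finitely many objects and morphisms). Let $\mathrm{RelFin}_{\mathcal B}$ be the following $(2,1)$-category. Its objects are the relatively finite functors $F:\mathcal G\to\mathcal B$. Its 1-morphisms from $F_1:\mathcal G_1\to\mathcal B$ to $F_2:\mathcal G_2\to\mathcal B$ are the pairs $(\Phi,\eta)$ of a functor $\Phi:\mathcal G_1\to\mathcal G_2$ and a natural isomorphism $\eta:F_1\Rightarrow F_2\Phi$. Its 2-morphisms $(\Phi_1,\eta_1)\Rightarrow(\Phi_2,\eta_2)$ are the natural isomorphisms $\psi:\Phi_1\Rightarrow\Phi_2$ with $\eta_2=F_2\psi\circ\eta_1$. Write $\mathrm{RelFin}_{\mathcal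 B}(F_1,F_2)$ for the groupoid of 1-morphisms $F_1\to F_2$ and 2-morphisms between them. For a finite group $H$ let $BH$ be the one-object groupoid with automorphism group $H$; every functor $BH\to\mathcal B$ is relatively finite. Theorem. Let $\mathcal B$ be a locally finite groupoid, and let $F:\mathcal G\to\mathcal B$ and $F':\mathcal G'\to\mathcal B$ be relatively finite functors such that for all finite groups $H$ and all functors $S:BH\to\mathcal B$ $$|\mathrm{RelFin}_{\mathcal B}(S,F)|=|\mathrm{RelFin}_{\mathcal B}(S,F')|.$$ Then $F$ and $F'$ are equivalent as objects of the $(2,1)$-category $\mathrm{RelFin}_{\mathcal B}$. -/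

import Mathlib

open CategoryTheory
open scoped ENNReal Bicategory

universe v u v₁ u₁

/-! ### Groupoid cardinality -/

/-- A groupoid is locally finite if all its hom-sets are finite. -/
def IsLocallyFiniteGroupoid (C : Type u) [Groupoid.{v} C] : Prop :=
  ∀ x y : C, Finite (x ⟶ y)

/-- The groupoid cardinality `∑ 1 / #Aut(x)`, summed over the isomorphism classes `[x]`,
as an element of `[0, ∞]`. (An infinite automorphism group would contribute `1 / ∞ = 0`; in a
locally finite groupoid there is none.) -/
noncomputable def groupoidCardinality (C : Type u) [Groupoid.{v} C] : ℝ≥0∞ :=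
  ∑' c : Quotient (isIsomorphicSetoid C),
    Quotient.lift (fun x : C => ((ENat.card (Aut x) : ENat) : ℝ≥0∞)⁻¹)
      (by
        rintro x y ⟨e⟩
        rw [ENat.card_congr (Aut.autMulEquivOfIso e).toEquiv]) c

/-! ### The slice (2,1)-category of groupoids over `B` -/

/-- An object of the slice over `B`: a groupoid with a functor to `B`. -/
structure GrpdOver (B : Type u) [Groupoid.{v} B] where
  /-- the total groupoid -/
  carrier : Type u₁
  /-- its groupoid structure -/
  [str : Groupoid.{v₁} carrier]
  /-- the functor to `B` -/
  functor : carrier ⥤ B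

attribute [instance] GrpdOver.str

namespace GrpdOver

variable {B : Type u} [Groupoid.{v} B]

/-- A 1-morphism `(Φ, η)` of the slice: a functor `Φ` between the total groupoids and a natural
isomorphism `η : F₁ ⇒ F₂ Φ`. -/
structure Hom (X Y : GrpdOver.{v, u, v₁, u₁} B) where
  /-- the functor `Φ` -/
  functor : X.carrier ⥤ Y.carrier
  /-- the natural isomorphism `η : F₁ ⇒ F₂ Φ` -/
  iso : X.functor ≅ functor ⋙ Y.functor

/-- A 2-morphism `(Φ₁, η₁) ⇒ (Φ₂, η₂)` of the slice: a natural transformation `ψ : Φ₁ ⇒ Φ₂`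
(automatically invertible, its target being a groupoid) with `η₂ = F₂ ψ ∘ η₁`. -/
@[ext]
structure Hom₂ {X Y : GrpdOver.{v, u, v₁, u₁} B} (f g : Hom X Y) where
  /-- the natural transformation `ψ` -/
  natTrans : f.functor ⟶ g.functor
  /-- the compatibility `η₂ = F₂ ψ ∘ η₁` -/
  w : f.iso.hom ≫ Functor.whiskerRight natTrans Y.functor = g.iso.hom

/-- The hom-groupoids of the slice. -/
instance homGroupoid (X Y : GrpdOver.{v, u, v₁, u₁} B) : Groupoid (Hom X Y) where
  Hom f g := Hom₂ f g
  id f := ⟨𝟙 f.functor, by simp⟩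
  comp a b := ⟨a.natTrans ≫ b.natTrans, by
    rw [Functor.whiskerRight_comp, ← Category.assoc, a.w, b.w]⟩
  id_comp a := Hom₂.ext (Category.id_comp _)
  comp_id a := Hom₂.ext (Category.comp_id _)
  assoc a b c := Hom₂.ext (Category.assoc _ _ _)
  inv {f g} a :=
    ⟨{ app := fun x => Groupoid.inv (a.natTrans.app x)
       naturality := fun x y k => by simp [Groupoid.inv_eq_inv] }, by
      rw [← a.w]
      ext x
      simp [Groupoid.inv_eq_inv]⟩
  inv_comp a := Hom₂.ext (by ext x; exact Groupoid.inv_comp _)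
  comp_inv a := Hom₂.ext (by ext x; exact Groupoid.comp_inv _)

instance categoryStruct : CategoryStruct (GrpdOver.{v, u, v₁, u₁} B) where
  Hom X Y := Hom X Y
  id X := ⟨𝟭 X.carrier, X.functor.leftUnitor.symm⟩
  comp {_ _ Z} f g := ⟨f.functor ⋙ g.functor,
    f.iso ≪≫ Functor.isoWhiskerLeft f.functor g.iso ≪≫
      (Functor.associator f.functor g.functor Z.functor).symm⟩

instance groupoidHom (X Y : GrpdOver.{v, u, v₁, u₁} B) : Groupoid (X ⟶ Y) :=
  inferInstanceAs (Groupoid (Hom X Y))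

theorem hom₂_ext {X Y : GrpdOver.{v, u, v₁, u₁} B} {f g : X ⟶ Y} {a b : f ⟶ g}
    (h : ∀ x, (Hom₂.natTrans a).app x = (Hom₂.natTrans b).app x) : a = b :=
  Hom₂.ext (NatTrans.ext (funext h))

/-- A natural transformation with the required compatibility, given componentwise. -/
def mkHom₂ {X Y : GrpdOver.{v, u, v₁, u₁} B} (f g : X ⟶ Y) (a : f.functor ⟶ g.functor)
    (w : ∀ x, f.iso.hom.app x ≫ Y.functor.map (a.app x) = g.iso.hom.app x) : f ⟶ g :=
  Hom₂.mk a (NatTrans.ext (funext w))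

/-- The isomorphism of 1-morphisms underlying a 2-morphism. -/
def isoOfHom₂ {X Y : GrpdOver.{v, u, v₁, u₁} B} {f g : X ⟶ Y} (a : f ⟶ g) : f ≅ g :=
  (Groupoid.isoEquivHom f g).symm a

@[simp]
theorem id_natTrans_app {X Y : GrpdOver.{v, u, v₁, u₁} B} (f : X ⟶ Y) (x : X.carrier) :
    (Hom₂.natTrans (𝟙 f)).app x = 𝟙 (f.functor.obj x) := rfl

@[simp]
theorem comp_natTrans_app {X Y : GrpdOver.{v, u, v₁, u₁} B} {f g h : X ⟶ Y}
    (a : f ⟶ g) (b : g ⟶ h) (x : X.carrier) :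
    (Hom₂.natTrans (a ≫ b)).app x = (Hom₂.natTrans a).app x ≫ (Hom₂.natTrans b).app x := rfl

@[simp]
theorem mkHom₂_natTrans {X Y : GrpdOver.{v, u, v₁, u₁} B} (f g : X ⟶ Y)
    (a : f.functor ⟶ g.functor) (w) : Hom₂.natTrans (mkHom₂ f g a w) = a := rfl

@[simp]
theorem isoOfHom₂_hom {X Y : GrpdOver.{v, u, v₁, u₁} B} {f g : X ⟶ Y} (a : f ⟶ g) :
    (isoOfHom₂ a).hom = a := rfl

@[simp]
theorem isoOfHom₂_inv_natTrans_app {X Y : GrpdOver.{v, u, v₁, u₁} B} {f g : X ⟶ Y} (a : f ⟶ g)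
    (x : X.carrier) :
    (Hom₂.natTrans (isoOfHom₂ a).inv).app x = inv ((Hom₂.natTrans a).app x) :=
  Groupoid.inv_eq_inv _

@[simp]
theorem id_functor (X : GrpdOver.{v, u, v₁, u₁} B) : Hom.functor (𝟙 X) = 𝟭 X.carrier := rfl

@[simp]
theorem comp_functor {X Y Z : GrpdOver.{v, u, v₁, u₁} B} (f : X ⟶ Y) (g : Y ⟶ Z) :
    Hom.functor (f ≫ g) = f.functor ⋙ g.functor := rfl

@[simp]
theorem id_iso_hom_app (X : GrpdOver.{v, u, v₁, u₁} B) (x : X.carrier) :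
    (Hom.iso (𝟙 X)).hom.app x = 𝟙 (X.functor.obj x) := rfl

@[simp]
theorem comp_iso_hom_app {X Y Z : GrpdOver.{v, u, v₁, u₁} B} (f : X ⟶ Y) (g : Y ⟶ Z)
    (x : X.carrier) :
    (Hom.iso (f ≫ g)).hom.app x = f.iso.hom.app x ≫ g.iso.hom.app (f.functor.obj x) := by
  change f.iso.hom.app x ≫ g.iso.hom.app (f.functor.obj x) ≫ 𝟙 _ = _
  rw [Category.comp_id]

theorem hom₂_w_app {X Y : GrpdOver.{v, u, v₁, u₁} B} {f g : X ⟶ Y} (a : f ⟶ g) (x : X.carrier) :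
    f.iso.hom.app x ≫ Y.functor.map ((Hom₂.natTrans a).app x) = g.iso.hom.app x :=
  NatTrans.congr_app (Hom₂.w a) x

/-- The slice (2,1)-category of groupoids over `B`. -/
instance bicategory : Bicategory (GrpdOver.{v, u, v₁, u₁} B) where
  homCategory X Y := (groupoidHom X Y).toCategory
  whiskerLeft {X Y Z} f g h a := mkHom₂ (f ≫ g) (f ≫ h)
    (Functor.whiskerLeft f.functor (Hom₂.natTrans a)) (fun x => by
      rw [comp_iso_hom_app, comp_iso_hom_app, ← hom₂_w_app a, Category.assoc]; rfl)
  whiskerRight {X Y Z} f g a h := mkHom₂ (f ≫ h) (g ≫ h)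
    (Functor.whiskerRight (Hom₂.natTrans a) h.functor) (fun x => by
      rw [comp_iso_hom_app, comp_iso_hom_app, ← hom₂_w_app a, Category.assoc, Category.assoc]
      exact congrArg _ (h.iso.hom.naturality ((Hom₂.natTrans a).app x)).symm)
  associator f g h := isoOfHom₂ (mkHom₂ ((f ≫ g) ≫ h) (f ≫ g ≫ h)
    (Functor.associator f.functor g.functor h.functor).hom (fun x => by simp))
  leftUnitor {X Y} f := isoOfHom₂ (mkHom₂ (𝟙 X ≫ f) f f.functor.leftUnitor.hom
    (fun x => by simp))
  rightUnitor {X Y} f := isoOfHom₂ (mkHom₂ (f ≫ 𝟙 Y) f f.functor.rightUnitor.hom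
    (fun x => by simp))
  whiskerLeft_id _ _ := hom₂_ext fun x => by simp
  whiskerLeft_comp _ _ _ _ _ _ := hom₂_ext fun x => by simp
  id_whiskerLeft _ := hom₂_ext fun x => by simp
  comp_whiskerLeft _ _ _ _ _ := hom₂_ext fun x => by simp
  id_whiskerRight _ _ := hom₂_ext fun x => by simp
  comp_whiskerRight _ _ _ := hom₂_ext fun x => by simp
  whiskerRight_id _ := hom₂_ext fun x => by simp
  whiskerRight_comp _ _ _ := hom₂_ext fun x => by simp
  whisker_assoc _ _ _ _ _ := hom₂_ext fun x => by simp
  whisker_exchange _ _ := hom₂_ext fun x => by simp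
  pentagon _ _ _ _ := hom₂_ext fun x => by simp
  triangle _ _ := hom₂_ext fun x => by simp

end GrpdOver

/-! ### Relatively finite functors -/

/-- The full inverse image `F⁻¹(y)`: the full subgroupoid of `G` on the objects `x` with
`F x ≅ y`. -/
abbrev fullInverseImage {B : Type u} [Groupoid.{v} B] {G : Type u₁} [Groupoid.{v₁} G]
    (F : G ⥤ B) (y : B) : Type u₁ :=
  ObjectProperty.FullSubcategory (fun x : G => Nonempty (F.obj x ≅ y))

/-- `F` is relatively finite if every full inverse image is equivalent to a groupoid with
finitely many objects and finitely many morphisms. -/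
def IsRelativelyFinite {B : Type u} [Groupoid.{v} B] {G : Type u₁} [Groupoid.{v₁} G]
    (F : G ⥤ B) : Prop :=
  ∀ y : B, ∃ (D : Type u₁) (_ : Groupoid.{v₁} D),
    Finite D ∧ (∀ a b : D, Finite (a ⟶ b)) ∧ Nonempty (fullInverseImage F y ≌ D)

/-- The objects of `RelFin_B`: groupoids over `B` whose structure functor is relatively finite. -/
structure RelFin (B : Type u) [Groupoid.{v} B] extends GrpdOver.{v, u, v₁, u₁} B where
  isRelativelyFinite : IsRelativelyFinite functor

namespace RelFin

variable {B : Type u} [Groupoid.{v} B]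

instance categoryStruct : CategoryStruct (RelFin.{v, u, v₁, u₁} B) where
  Hom X Y := X.toGrpdOver ⟶ Y.toGrpdOver
  id X := 𝟙 X.toGrpdOver
  comp {X Y Z} (f : X.toGrpdOver ⟶ Y.toGrpdOver) (g : Y.toGrpdOver ⟶ Z.toGrpdOver) := f ≫ g

/-- The hom-groupoids of `RelFin_B` are those of the slice. -/
instance groupoidHom (X Y : RelFin.{v, u, v₁, u₁} B) : Groupoid (X ⟶ Y) :=
  inferInstanceAs (Groupoid (X.toGrpdOver ⟶ Y.toGrpdOver))

/-- `RelFin_B` as a full sub-(2,1)-category of the slice over `B`. -/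
instance bicategory : Bicategory (RelFin.{v, u, v₁, u₁} B) where
  homCategory X Y := (groupoidHom X Y).toCategory
  whiskerLeft {X Y Z} f g h a := GrpdOver.bicategory.whiskerLeft (a := X.toGrpdOver)
    (b := Y.toGrpdOver) (c := Z.toGrpdOver) f (g := g) (h := h) a
  whiskerRight {X Y Z} f g a h := GrpdOver.bicategory.whiskerRight (a := X.toGrpdOver)
    (b := Y.toGrpdOver) (c := Z.toGrpdOver) (f := f) (g := g) a h
  associator {W X Y Z} f g h := GrpdOver.bicategory.associator (a := W.toGrpdOver)
    (b := X.toGrpdOver) (c := Y.toGrpdOver) (d := Z.toGrpdOver) f g h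
  leftUnitor {X Y} f := GrpdOver.bicategory.leftUnitor (a := X.toGrpdOver) (b := Y.toGrpdOver) f
  rightUnitor {X Y} f := GrpdOver.bicategory.rightUnitor (a := X.toGrpdOver) (b := Y.toGrpdOver) f
  whiskerLeft_id _ _ := GrpdOver.bicategory.whiskerLeft_id _ _
  whiskerLeft_comp _ _ _ _ _ _ := GrpdOver.bicategory.whiskerLeft_comp _ _ _
  id_whiskerLeft _ := GrpdOver.bicategory.id_whiskerLeft _
  comp_whiskerLeft _ _ _ _ _ := GrpdOver.bicategory.comp_whiskerLeft _ _ _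
  id_whiskerRight _ _ := GrpdOver.bicategory.id_whiskerRight _ _
  comp_whiskerRight _ _ _ := GrpdOver.bicategory.comp_whiskerRight _ _ _
  whiskerRight_id _ := GrpdOver.bicategory.whiskerRight_id _
  whiskerRight_comp _ _ _ := GrpdOver.bicategory.whiskerRight_comp _ _ _
  whisker_assoc _ _ _ _ _ := GrpdOver.bicategory.whisker_assoc _ _ _
  whisker_exchange _ _ := GrpdOver.bicategory.whisker_exchange _ _
  pentagon _ _ _ _ := GrpdOver.bicategory.pentagon _ _ _ _
  triangle _ _ := GrpdOver.bicategory.triangle _ _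

/-- A relatively finite functor as an object of `RelFin_B`. -/
def of {G : Type u₁} [Groupoid.{v₁} G] (F : G ⥤ B) (hF : IsRelativelyFinite F) :
    RelFin.{v, u, v₁, u₁} B where
  carrier := G
  functor := F
  isRelativelyFinite := hF

end RelFin

/-! ### Functors out of deloopings of finite groups -/

/-- The delooping `BH` of a group `H` (Mathlib's `SingleObj H`), with its one-element set of
objects lifted to the universe of objects of `RelFin_B`; this is again a groupoid. -/
instance deloopingGroupoid (H : Type v₁) [Group H] :
    Groupoid.{v₁} (ULift.{u₁} (SingleObj H)) where
  toCategory := uliftCategory (SingleObj H)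
  inv {x y} f := (Groupoid.inv (show x.down ⟶ y.down from f) : y.down ⟶ x.down)
  inv_comp {x y} f := Groupoid.inv_comp (show x.down ⟶ y.down from f)
  comp_inv {x y} f := Groupoid.comp_inv (show x.down ⟶ y.down from f)

theorem isRelativelyFinite_of_finite_group {B : Type u} [Groupoid.{v} B] {H : Type v₁} [Group H]
    [Finite H] (S : SingleObj H ⥤ B) :
    IsRelativelyFinite (ULift.downFunctor.{v₁, 0, u₁} ⋙ S) := by
  intro y
  have hfin : Finite (fullInverseImage (ULift.downFunctor.{v₁, 0, u₁} ⋙ S) y) :=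
    Finite.of_injective (fun x => x.obj) (fun a b h => ObjectProperty.FullSubcategory.ext h)
  refine ⟨fullInverseImage (ULift.downFunctor.{v₁, 0, u₁} ⋙ S) y,
    InducedCategory.groupoid _ _, hfin, fun a b => ?_, ⟨.refl⟩⟩
  have : Finite (a.obj ⟶ b.obj) := inferInstanceAs (Finite H)
  exact Finite.of_injective (fun f : a ⟶ b => f.hom) (fun f g h => InducedCategory.hom_ext h)

/-- For a finite group `H`, a functor `S : BH ⥤ B` as an object of `RelFin_B`. -/
def RelFin.ofGroup {B : Type u} [Groupoid.{v} B] {H : Type v₁} [Group H] [Finite H]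
    (S : SingleObj H ⥤ B) : RelFin.{v, u, v₁, u₁} B :=
  RelFin.of (ULift.downFunctor ⋙ S) (isRelativelyFinite_of_finite_group S)

/-! ### Cancellation in sums of extended nonnegative reals -/

/-! The argument is Lovász's: homomorphism counts determine an object, because they determine the
counts of injections. Choose a representative `x` of each isomorphism class of `G`. Up to
equivalence, `F` is the family of actions of the finite groups `End x` on the objects `F x`. A
1-morphism from a functor `S : BH ⥤ B` amounts to a representative `x` and a morphism of actions
from `S` to that of `End x`, and isomorphisms correspond to the action of `End x` on these
morphisms. Orbit counting (`groupoidCardinality_eq_mass`) then turns the groupoid cardinality into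
the sum over `x` of the number of morphisms divided by the order of `End x`.

Sorting morphisms by kernel, those with kernel `N` are the injective morphisms out of the quotient
by `N`. Induction on the order of the group gives equal weighted counts of injective morphisms
(`injMass_eq_of_mass_eq`). An injection that is not an isomorphism strictly increases the order, so
these counts form a triangular system in the multiplicities of the isomorphism classes. Orders are
bounded over each component of `B`, so the system can be solved downwards
(`multiplicity_eq_of_injMass_eq`). Equal multiplicities match the representatives for `F` and `F'`,
and the matched actions assemble into an equivalence over `B`. Relative finiteness, together with
local finiteness of `B`, keeps every sum finite, which is what permits subtraction in `ℝ≥0∞`. -/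

theorem ENNReal.eq_of_tsum_eq_of_eq_off {α : Type*} {f g : α → ℝ≥0∞} (a : α)
    (hsum : ∑' x, f x = ∑' x, g x) (hfin : ∑' x, f x ≠ ∞) (hoff : ∀ x, x ≠ a → f x = g x) :
    f a = g a := by
  classical
  rw [ENNReal.tsum_eq_add_tsum_ite a] at hsum hfin
  rw [ENNReal.tsum_eq_add_tsum_ite (f := g) a] at hsum
  have hrest : (∑' x, if x = a then 0 else f x) = ∑' x, if x = a then 0 else g x :=
    tsum_congr fun x => by
      split_ifs with h
      · rfl
      · exact hoff x h
  rw [← hrest] at hsum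
  exact (ENNReal.add_left_inj (ENNReal.add_ne_top.1 hfin).2).1 hsum

theorem ENNReal.tsum_ne_top_of_finite {α : Type*} {f : α → ℝ≥0∞} {s : Set α} (hs : s.Finite)
    (hzero : ∀ x ∉ s, f x = 0) (hf : ∀ x, f x ≠ ∞) : ∑' x, f x ≠ ∞ := by
  rw [tsum_eq_sum (s := hs.toFinset) fun x hx => hzero x (by simpa using hx)]
  exact (ENNReal.sum_ne_top).2 fun x _ => hf x

/-! ### Finite groups acting on objects of a groupoid -/

/-- A finite group acting on an object of the groupoid `B`; equivalently, a functor to `B` from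
the delooping of a finite group. -/
structure ObjAction (B : Type u) [Groupoid.{v} B] where
  /-- the acting group -/
  group : Type v₁
  [str : Group group]
  [fin : Finite group]
  /-- the object acted on -/
  obj : B
  /-- the action -/
  hom : group →* End obj

namespace ObjAction

attribute [instance] ObjAction.str ObjAction.fin

variable {B : Type u} [Groupoid.{v} B]

/-- A morphism of actions: a group homomorphism and a compatible morphism of the objects. -/
@[ext]
structure Mor (S T : ObjAction.{v, u, v₁} B) where
  /-- the group homomorphism -/
  hom : S.group →* T.group
  /-- the morphism of objects -/
  map : S.obj ⟶ T.obj
  comm : ∀ h, (S.hom h : S.obj ⟶ S.obj) ≫ map = map ≫ (T.hom (hom h) : T.obj ⟶ T.obj)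

theorem finite_mor (hB : IsLocallyFiniteGroupoid B) (S T : ObjAction.{v, u, v₁} B) :
    Finite (Mor S T) := by
  have := hB S.obj T.obj
  exact Finite.of_injective
    (fun p : Mor S T => ((⇑p.hom : S.group → T.group), p.map)) fun p q h => by
      obtain ⟨h₁, h₂⟩ := Prod.ext_iff.1 h
      exact Mor.ext (DFunLike.coe_injective h₁) h₂

/-- The identity morphism. -/
def Mor.id (S : ObjAction.{v, u, v₁} B) : Mor S S where
  hom := MonoidHom.id _
  map := 𝟙 _
  comm h := by simp

/-- Composition of morphisms. -/
def Mor.comp {S T U : ObjAction.{v, u, v₁} B} (p : Mor S T) (q : Mor T U) : Mor S U where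
  hom := q.hom.comp p.hom
  map := p.map ≫ q.map
  comm h := by
    rw [← Category.assoc, p.comm, Category.assoc, q.comm, Category.assoc]; rfl

/-- The inverse of a morphism whose group homomorphism is bijective. -/
noncomputable def Mor.inv {S T : ObjAction.{v, u, v₁} B} (p : Mor S T)
    (hp : Function.Bijective p.hom) : Mor T S where
  hom := (MulEquiv.ofBijective p.hom hp).symm.toMonoidHom
  map := CategoryTheory.inv p.map
  comm h := by
    obtain ⟨g, rfl⟩ := hp.2 h
    have e : (MulEquiv.ofBijective p.hom hp).symm.toMonoidHom (p.hom g) = g :=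
      (MulEquiv.ofBijective p.hom hp).symm_apply_apply g
    rw [e, IsIso.comp_inv_eq, Category.assoc, p.comm, IsIso.inv_hom_id_assoc]

theorem Mor.inv_hom_bijective {S T : ObjAction.{v, u, v₁} B} (p : Mor S T)
    (hp : Function.Bijective p.hom) : Function.Bijective (p.inv hp).hom :=
  (MulEquiv.ofBijective p.hom hp).symm.bijective

/-- Two actions are isomorphic if some morphism between them is bijective on groups. -/
instance setoid : Setoid (ObjAction.{v, u, v₁} B) where
  r S T := ∃ p : Mor S T, Function.Bijective p.hom
  iseqv :=
    { refl := fun S => ⟨Mor.id S, Function.bijective_id⟩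
      symm := fun ⟨p, hp⟩ => ⟨p.inv hp, p.inv_hom_bijective hp⟩
      trans := fun ⟨p, hp⟩ ⟨q, hq⟩ => ⟨p.comp q, hq.comp hp⟩ }

/-- Injective morphisms of actions. -/
abbrev InjMor (S T : ObjAction.{v, u, v₁} B) : Type _ :=
  { p : Mor S T // Function.Injective p.hom }

/-- Composition with an isomorphism does not change the number of injective morphisms. -/
noncomputable def injMorCongr (S : ObjAction.{v, u, v₁} B) {T U : ObjAction.{v, u, v₁} B}
    (p : Mor T U) (hp : Function.Bijective p.hom) : InjMor S T ≃ InjMor S U where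
  toFun q := ⟨q.1.comp p, hp.1.comp q.2⟩
  invFun q := ⟨q.1.comp (p.inv hp), (p.inv_hom_bijective hp).1.comp q.2⟩
  left_inv q := Subtype.ext <| Mor.ext
    (MonoidHom.ext fun g => (MulEquiv.ofBijective p.hom hp).symm_apply_apply (q.1.hom g))
    (by simp [Mor.comp, Mor.inv])
  right_inv q := Subtype.ext <| Mor.ext
    (MonoidHom.ext fun g => (MulEquiv.ofBijective p.hom hp).apply_symm_apply (q.1.hom g))
    (by simp [Mor.comp, Mor.inv])

/-! ### Passing to a quotient of the acting group -/

/-- The action of a quotient by a normal subgroup that acts trivially. -/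
def quotient (S : ObjAction.{v, u, v₁} B) (N : Subgroup S.group) [N.Normal]
    (hN : N ≤ S.hom.ker) : ObjAction.{v, u, v₁} B where
  group := S.group ⧸ N
  obj := S.obj
  hom := QuotientGroup.lift N S.hom hN

/-- Since `p.map` is invertible, an element killed by `p.hom` must act trivially on `S.obj`. Hence
the action of `S` descends to the quotient by the kernel of any morphism. -/
theorem Mor.ker_le {S T : ObjAction.{v, u, v₁} B} (p : Mor S T) : p.hom.ker ≤ S.hom.ker := by
  intro g hg
  have h := p.comm g
  rw [MonoidHom.mem_ker.1 hg, map_one] at h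
  have hcomp : (S.hom g : S.obj ⟶ S.obj) ≫ p.map = 𝟙 _ ≫ p.map := by
    rw [h, Category.id_comp]; exact Category.comp_id _
  exact (cancel_mono p.map).1 hcomp

/-- Injective morphisms from the quotient by `N` are the morphisms with kernel `N`. -/
noncomputable def injMorQuotient (S T : ObjAction.{v, u, v₁} B) (N : Subgroup S.group) [N.Normal]
    (hN : N ≤ S.hom.ker) : InjMor (S.quotient N hN) T ≃ { p : Mor S T // p.hom.ker = N } where
  toFun q := ⟨⟨q.1.hom.comp (QuotientGroup.mk' N), q.1.map, fun h => q.1.comm (h : S.group ⧸ N)⟩,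
    by
      ext g
      rw [MonoidHom.mem_ker]
      change q.1.hom (g : S.group ⧸ N) = 1 ↔ _
      rw [← QuotientGroup.eq_one_iff]
      exact map_eq_one_iff _ q.2⟩
  invFun p := ⟨⟨QuotientGroup.lift N p.1.hom p.2.ge, p.1.map, fun h => by
      induction h using QuotientGroup.induction_on with
      | H g => exact p.1.comm g⟩, by
      change Function.Injective (QuotientGroup.lift N p.1.hom p.2.ge)
      rw [injective_iff_map_eq_one]
      intro h
      induction h using QuotientGroup.induction_on with
      | H g =>
        intro hg
        exact (QuotientGroup.eq_one_iff g).2 (p.2 ▸ MonoidHom.mem_ker.2 hg)⟩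
  left_inv q := Subtype.ext <| Mor.ext (QuotientGroup.monoidHom_ext _ rfl) rfl
  right_inv p := Subtype.ext <| Mor.ext rfl rfl

/-! ### Weighted counts of morphisms into a family of actions -/

section Mass

variable {I J : Type*}

/-- The number of morphisms from `S` to the members of the family `T`, each weighted by the
inverse of the order of the target group. -/
noncomputable def mass (T : I → ObjAction.{v, u, v₁} B) (S : ObjAction.{v, u, v₁} B) : ℝ≥0∞ :=
  ∑' i, ∑' _ : Mor S (T i), ((ENat.card (T i).group : ENat) : ℝ≥0∞)⁻¹

/-- The weighted number of injective morphisms from `S` to the members of the family `T`. -/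
noncomputable def injMass (T : I → ObjAction.{v, u, v₁} B) (S : ObjAction.{v, u, v₁} B) : ℝ≥0∞ :=
  ∑' i, ∑' _ : InjMor S (T i), ((ENat.card (T i).group : ENat) : ℝ≥0∞)⁻¹

/-- Only finitely many members of the family act on objects isomorphic to a given one. -/
def IsRelFinFamily (T : I → ObjAction.{v, u, v₁} B) : Prop :=
  ∀ y : B, { i | Nonempty ((T i).obj ⟶ y) }.Finite

theorem inv_card_ne_top (T : ObjAction.{v, u, v₁} B) :
    ((ENat.card T.group : ENat) : ℝ≥0∞)⁻¹ ≠ ∞ := by simp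

theorem inv_card_ne_zero (T : ObjAction.{v, u, v₁} B) :
    ((ENat.card T.group : ENat) : ℝ≥0∞)⁻¹ ≠ 0 := by
  simpa using T.fin

/-- A morphism from `S` includes an isomorphism of the objects acted on, so only finitely many
members of the family contribute, each with finitely many morphisms. -/
theorem mass_ne_top (hB : IsLocallyFiniteGroupoid B) {T : I → ObjAction.{v, u, v₁} B}
    (hT : IsRelFinFamily T) (S : ObjAction.{v, u, v₁} B) : mass T S ≠ ∞ := by
  refine ENNReal.tsum_ne_top_of_finite (hT S.obj) (fun i hi => ?_) fun i => ?_
  · have : IsEmpty (Mor S (T i)) := ⟨fun p => hi ⟨CategoryTheory.inv p.map⟩⟩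
    exact tsum_empty
  · have := finite_mor hB S (T i)
    exact ENNReal.tsum_ne_top_of_finite Set.finite_univ (by simp) fun _ => inv_card_ne_top _

theorem injMass_le_mass (T : I → ObjAction.{v, u, v₁} B) (S : ObjAction.{v, u, v₁} B) :
    injMass T S ≤ mass T S :=
  ENNReal.tsum_le_tsum fun _ =>
    ENNReal.tsum_comp_le_tsum_of_injective Subtype.val_injective _

/-- The weighted number of morphisms with kernel `N`. -/
noncomputable def kerMass (T : I → ObjAction.{v, u, v₁} B) (S : ObjAction.{v, u, v₁} B)
    (N : Subgroup S.group) : ℝ≥0∞ :=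
  ∑' i, ∑' _ : { p : Mor S (T i) // p.hom.ker = N }, ((ENat.card (T i).group : ENat) : ℝ≥0∞)⁻¹

theorem mass_eq_tsum_kerMass (T : I → ObjAction.{v, u, v₁} B) (S : ObjAction.{v, u, v₁} B) :
    mass T S = ∑' N, kerMass T S N := by
  unfold kerMass
  rw [ENNReal.tsum_comm]
  exact tsum_congr fun i => (ENNReal.tsum_fiberwise _ fun p : Mor S (T i) => p.hom.ker).symm

theorem kerMass_bot (T : I → ObjAction.{v, u, v₁} B) (S : ObjAction.{v, u, v₁} B) :
    kerMass T S ⊥ = injMass T S :=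
  tsum_congr fun i =>
    (Equiv.subtypeEquivRight fun p : Mor S (T i) => MonoidHom.ker_eq_bot_iff p.hom).tsum_eq
      fun _ => ((ENat.card (T i).group : ENat) : ℝ≥0∞)⁻¹

theorem kerMass_eq_injMass_quotient (T : I → ObjAction.{v, u, v₁} B) (S : ObjAction.{v, u, v₁} B)
    (N : Subgroup S.group) [N.Normal] (hN : N ≤ S.hom.ker) :
    kerMass T S N = injMass T (S.quotient N hN) :=
  tsum_congr fun i => ((injMorQuotient S (T i) N hN).tsum_eq
    fun _ => ((ENat.card (T i).group : ENat) : ℝ≥0∞)⁻¹).symm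

theorem kerMass_eq_zero (T : I → ObjAction.{v, u, v₁} B) (S : ObjAction.{v, u, v₁} B)
    (N : Subgroup S.group) (hN : ¬ (N.Normal ∧ N ≤ S.hom.ker)) : kerMass T S N = 0 := by
  refine ENNReal.tsum_eq_zero.2 fun i => ?_
  have : IsEmpty { p : Mor S (T i) // p.hom.ker = N } :=
    ⟨fun p => hN (p.2 ▸ ⟨inferInstance, p.1.ker_le⟩)⟩
  exact tsum_empty

/-- If all weighted counts of morphisms agree, then so do those of injective morphisms. -/
theorem injMass_eq_of_mass_eq (hB : IsLocallyFiniteGroupoid B) {T : I → ObjAction.{v, u, v₁} B}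
    {T' : J → ObjAction.{v, u, v₁} B} (hT : IsRelFinFamily T)
    (hmass : ∀ S, mass T S = mass T' S) (S : ObjAction.{v, u, v₁} B) :
    injMass T S = injMass T' S := by
  -- In the sum of `kerMass` over all subgroups, every `N ≠ ⊥` contributes either zero or the
  -- injective count of a strictly smaller group; cancelling these leaves the term at `⊥`.
  induction hn : Nat.card S.group using Nat.strong_induction_on generalizing S with
  | _ n ih =>
  rw [← kerMass_bot, ← kerMass_bot]
  refine ENNReal.eq_of_tsum_eq_of_eq_off ⊥ ?_ ?_ fun N hN => ?_
  · rw [← mass_eq_tsum_kerMass, ← mass_eq_tsum_kerMass, hmass]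
  · rw [← mass_eq_tsum_kerMass]
    exact mass_ne_top hB hT S
  · by_cases h : N.Normal ∧ N ≤ S.hom.ker
    · have := h.1
      rw [kerMass_eq_injMass_quotient T S N h.2, kerMass_eq_injMass_quotient T' S N h.2]
      refine ih _ ?_ _ rfl
      change Nat.card (S.group ⧸ N) < n
      have h₁ := N.card_eq_card_quotient_mul_card_subgroup
      have h₂ : 1 < Nat.card N := (Subgroup.one_lt_card_iff_ne_bot N).2 hN
      have h₃ : 0 < Nat.card (S.group ⧸ N) := Nat.card_pos
      rw [← hn, h₁]
      exact lt_mul_of_one_lt_right h₃ h₂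
    · rw [kerMass_eq_zero T' S N h, kerMass_eq_zero T S N h]

/-! ### Multiplicities from counts of injective morphisms -/

/-- The weight with which an isomorphism class of actions contributes to the count of injective
morphisms from `S`. -/
noncomputable def classWeight (S : ObjAction.{v, u, v₁} B)
    (c : Quotient (setoid (B := B))) : ℝ≥0∞ :=
  Quotient.lift (fun T : ObjAction.{v, u, v₁} B =>
    ∑' _ : InjMor S T, ((ENat.card T.group : ENat) : ℝ≥0∞)⁻¹) (by
      rintro T U ⟨p, hp⟩
      change ∑' _ : InjMor S T, _ = ∑' _ : InjMor S U, _
      rw [ENat.card_congr (MulEquiv.ofBijective p.hom hp).toEquiv]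
      exact (injMorCongr S p hp).tsum_eq fun _ => ((ENat.card U.group : ENat) : ℝ≥0∞)⁻¹) c

/-- The number of members of the family in a given isomorphism class. -/
noncomputable def multiplicity (T : I → ObjAction.{v, u, v₁} B)
    (c : Quotient (setoid (B := B))) : ENat :=
  ENat.card { i // (⟦T i⟧ : Quotient (setoid (B := B))) = c }

theorem injMass_eq_tsum_classWeight (T : I → ObjAction.{v, u, v₁} B)
    (S : ObjAction.{v, u, v₁} B) :
    injMass T S = ∑' c, (multiplicity T c : ℝ≥0∞) * classWeight S c := by
  unfold injMass
  rw [← ENNReal.tsum_fiberwise _ fun i => (⟦T i⟧ : Quotient (setoid (B := B)))]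
  refine tsum_congr fun c => ?_
  rw [multiplicity, ← ENNReal.tsum_const]
  exact tsum_congr fun i => by
    obtain ⟨i, rfl⟩ := i
    rfl

theorem exists_card_le {T : I → ObjAction.{v, u, v₁} B} (hT : IsRelFinFamily T) (y : B) :
    ∃ M : ℕ, ∀ i, Nonempty ((T i).obj ⟶ y) → Nat.card (T i).group ≤ M := by
  obtain ⟨M, hM⟩ := ((hT y).image fun i => Nat.card (T i).group).bddAbove
  exact ⟨M, fun i hi => hM ⟨i, hi, rfl⟩⟩

theorem multiplicity_eq_zero {T : I → ObjAction.{v, u, v₁} B} {y : B} {M : ℕ}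
    (hM : ∀ i, Nonempty ((T i).obj ⟶ y) → Nat.card (T i).group ≤ M)
    {S : ObjAction.{v, u, v₁} B} (hy : Nonempty (S.obj ⟶ y)) (hS : M < Nat.card S.group) :
    multiplicity T ⟦S⟧ = 0 := by
  rw [multiplicity, ENat.card_eq_zero_iff_empty]
  refine ⟨fun ⟨i, hi⟩ => ?_⟩
  obtain ⟨p, hp⟩ := Quotient.exact hi
  obtain ⟨k⟩ := hy
  have := hM i ⟨p.map ≫ k⟩
  rw [Nat.card_congr (Equiv.ofBijective p.hom hp)] at this
  omega

theorem classWeight_self_ne_zero (S : ObjAction.{v, u, v₁} B) : classWeight S ⟦S⟧ ≠ 0 := by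
  intro h
  exact inv_card_ne_zero S (ENNReal.tsum_eq_zero.1 h ⟨Mor.id S, Function.injective_id⟩)

theorem classWeight_self_ne_top (hB : IsLocallyFiniteGroupoid B) (S : ObjAction.{v, u, v₁} B) :
    classWeight S ⟦S⟧ ≠ ∞ := by
  have := finite_mor hB S S
  exact ENNReal.tsum_ne_top_of_finite (Set.toFinite Set.univ) (by simp)
    fun _ => inv_card_ne_top S

/-- The weighted counts of injective morphisms determine the multiplicities. -/
theorem multiplicity_eq_of_injMass_eq (hB : IsLocallyFiniteGroupoid B)
    {T : I → ObjAction.{v, u, v₁} B} {T' : J → ObjAction.{v, u, v₁} B} (hT : IsRelFinFamily T)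
    (hT' : IsRelFinFamily T') (hinj : ∀ S, injMass T S = injMass T' S)
    (c : Quotient (setoid (B := B))) : multiplicity T c = multiplicity T' c := by
  induction c using Quotient.inductionOn with
  | _ S₀ =>
  obtain ⟨M, hM⟩ := exists_card_le hT S₀.obj
  obtain ⟨M', hM'⟩ := exists_card_le hT' S₀.obj
  -- Downward induction on the group order within the component of `S₀.obj`: `k` bounds how far the
  -- order may lie below the range where both multiplicities vanish. The value `max M M' + 1`
  -- imposes no condition on the order.
  suffices H : ∀ (k : ℕ) (S : ObjAction.{v, u, v₁} B), Nonempty (S.obj ⟶ S₀.obj) →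
      max M M' < Nat.card S.group + k → multiplicity T ⟦S⟧ = multiplicity T' ⟦S⟧ from
    H (max M M' + 1) S₀ ⟨𝟙 _⟩ (by omega)
  intro k
  induction k with
  | zero =>
    intro S hS hk
    rw [multiplicity_eq_zero hM hS (by omega), multiplicity_eq_zero hM' hS (by omega)]
  | succ k ih =>
    intro S hS hk
    have key := ENNReal.eq_of_tsum_eq_of_eq_off
      (f := fun c => (multiplicity T c : ℝ≥0∞) * classWeight S c)
      (g := fun c => (multiplicity T' c : ℝ≥0∞) * classWeight S c) ⟦S⟧
      (by rw [← injMass_eq_tsum_classWeight, ← injMass_eq_tsum_classWeight, hinj])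
      (by
        rw [← injMass_eq_tsum_classWeight]
        exact ne_top_of_le_ne_top (mass_ne_top hB hT S) (injMass_le_mass T S))
      (fun c hc => by
        induction c using Quotient.inductionOn with
        | _ U =>
        -- A class other than that of `S` either receives no injection from `S`, so has weight zero,
        -- or has strictly larger order and lies in the same component, so the induction hypothesis
        -- applies.
        by_cases hU : Nonempty (InjMor S U)
        · obtain ⟨p, hp⟩ := hU
          have hle : Nat.card S.group ≤ Nat.card U.group := Nat.card_le_card_of_injective _ hp
          have hlt : Nat.card S.group < Nat.card U.group := by
            refine lt_of_le_of_ne hle fun heq => hc (Quotient.sound (Setoid.symm ⟨p, ?_⟩))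
            exact (Nat.bijective_iff_injective_and_card _).2 ⟨hp, heq⟩
          obtain ⟨s⟩ := hS
          simp only [ih U ⟨CategoryTheory.inv p.map ≫ s⟩ (by omega)]
        · rw [not_nonempty_iff] at hU
          have : classWeight S ⟦U⟧ = 0 := tsum_empty
          simp only [this, mul_zero])
    have := (ENNReal.mul_left_inj (classWeight_self_ne_zero S)
      (classWeight_self_ne_top hB S)).1 key
    exact_mod_cast this

theorem finite_fiber {T : I → ObjAction.{v, u, v₁} B} (hT : IsRelFinFamily T)
    (c : Quotient (setoid (B := B))) :
    Finite { i // (⟦T i⟧ : Quotient (setoid (B := B))) = c } := by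
  induction c using Quotient.inductionOn with
  | _ S =>
  refine ((hT S.obj).subset fun i hi => ?_).to_subtype
  obtain ⟨p, -⟩ := Quotient.exact hi
  exact ⟨p.map⟩

/-- Families with the same weighted counts of morphisms agree up to a bijection of the index
sets and isomorphisms of the members. -/
theorem exists_equiv_of_mass_eq (hB : IsLocallyFiniteGroupoid B)
    {T : I → ObjAction.{v, u, v₁} B} {T' : J → ObjAction.{v, u, v₁} B} (hT : IsRelFinFamily T)
    (hT' : IsRelFinFamily T') (hmass : ∀ S, mass T S = mass T' S) :
    ∃ e : I ≃ J, ∀ i, ∃ p : Mor (T i) (T' (e i)), Function.Bijective p.hom := by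
  have hfiber : ∀ c : Quotient (setoid (B := B)),
      Nonempty ({ i // (⟦T i⟧ : Quotient (setoid (B := B))) = c } ≃
        { j // (⟦T' j⟧ : Quotient (setoid (B := B))) = c }) := fun c => by
    -- Equal extended multiplicities yield a bijection only because the fibres are finite.
    have := finite_fiber hT c
    have := finite_fiber hT' c
    have h := multiplicity_eq_of_injMass_eq hB hT hT' (injMass_eq_of_mass_eq hB hT hmass) c
    simp only [multiplicity, ENat.card_eq_coe_natCard, Nat.cast_inj] at h
    exact Finite.card_eq.1 h
  let e : I ≃ J := Equiv.ofFiberEquiv fun c => (hfiber c).some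
  exact ⟨e, fun i => Quotient.exact
    (Equiv.ofFiberEquiv_map (fun c => (hfiber c).some) i).symm⟩

end Mass

end ObjAction

/-! ### Groupoid cardinality by orbit counting -/

/-- By orbit–stabilizer, an orbit has `#A / #Stab` points, so its points of weight `1 / #A` add up
to `1 / #Stab`. -/
theorem tsum_inv_card_eq_tsum_orbits (A P : Type*) [Group A] [Finite A] [MulAction A P] :
    ∑' _ : P, ((ENat.card A : ENat) : ℝ≥0∞)⁻¹ =
      ∑' ω : MulAction.orbitRel.Quotient A P,
        ((ENat.card (MulAction.stabilizer A ω.out) : ENat) : ℝ≥0∞)⁻¹ := by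
  rw [← (MulAction.selfEquivSigmaOrbitsQuotientStabilizer A P).symm.tsum_eq, ENNReal.tsum_sigma']
  refine tsum_congr fun ω => ?_
  rw [ENNReal.tsum_const]
  have h := (MulAction.stabilizer A ω.out).card_eq_card_quotient_mul_card_subgroup
  have hpos : Nat.card (A ⧸ MulAction.stabilizer A ω.out) ≠ 0 := Nat.card_pos.ne'
  simp only [ENat.card_eq_coe_natCard, ENat.toENNReal_coe]
  rw [h, Nat.cast_mul, ENNReal.mul_inv (by simp) (by simp), ← mul_assoc,
    ENNReal.mul_inv_cancel (by exact_mod_cast hpos) (by simp), one_mul]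

/-- A groupoid whose objects are, up to isomorphism, parametrized by the sets `P i` with actions
of finite groups `A i`, isomorphisms corresponding to group elements. -/
theorem groupoidCardinality_eq_tsum_of_actions {C : Type*} [Groupoid C] {I : Type*}
    {A P : I → Type*} [∀ i, Group (A i)] [∀ i, Finite (A i)] [∀ i, MulAction (A i) (P i)]
    (t : ∀ i, P i → C) (hsurj : ∀ c, ∃ i p, Nonempty (t i p ≅ c))
    (hindex : ∀ i j p q, Nonempty (t i p ≅ t j q) → i = j)
    (horbit : ∀ i p q, Nonempty (t i p ≅ t i q) ↔ ∃ g : A i, g • p = q)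
    (hstab : ∀ i p, Nonempty (Aut (t i p) ≃ MulAction.stabilizer (A i) p)) :
    groupoidCardinality C = ∑' i, ∑' _ : P i, ((ENat.card (A i) : ENat) : ℝ≥0∞)⁻¹ := by
  -- Isomorphism classes of `C` are the orbits of all the `A i` together.
  let q : (Σ i, MulAction.orbitRel.Quotient (A i) (P i)) → Quotient (isIsomorphicSetoid C) :=
    fun w => ⟦t w.1 w.2.out⟧
  have hq : Function.Bijective q := by
    constructor
    · rintro ⟨i, ω⟩ ⟨j, ω'⟩ h
      have hiso : Nonempty (t i ω.out ≅ t j ω'.out) := Quotient.exact h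
      obtain rfl := hindex _ _ _ _ hiso
      obtain ⟨g, hg⟩ := (horbit _ _ _).1 hiso
      have : ω = ω' := by
        rw [← Quotient.out_eq ω, ← Quotient.out_eq ω', ← hg]
        exact MulAction.orbitRel.Quotient.quotient_smul_eq.symm
      rw [this]
    · intro c
      induction c using Quotient.inductionOn with
      | _ c =>
      obtain ⟨i, p, ⟨e⟩⟩ := hsurj c
      obtain ⟨g, hg⟩ : ∃ g : A i, g • p =
          (⟦p⟧ : MulAction.orbitRel.Quotient (A i) (P i)).out :=
        Quotient.mk_out (s := MulAction.orbitRel (A i) (P i)) p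
      obtain ⟨e'⟩ := (horbit _ _ _).2 ⟨g, hg⟩
      exact ⟨⟨i, ⟦p⟧⟩, Quotient.sound ⟨e'.symm ≪≫ e⟩⟩
  unfold groupoidCardinality
  rw [← (Equiv.ofBijective q hq).tsum_eq, ENNReal.tsum_sigma']
  refine tsum_congr fun i => ?_
  rw [tsum_inv_card_eq_tsum_orbits]
  refine tsum_congr fun ω => ?_
  change ((ENat.card (Aut (t i ω.out)) : ENat) : ℝ≥0∞)⁻¹ = _
  rw [ENat.card_congr (hstab i ω.out).some]

/-! ### 1-morphisms out of `BH` as morphisms of actions -/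

namespace ObjAction

variable {B : Type u} [Groupoid.{v} B]

/-- The target group acts on morphisms of actions, by conjugation on group homomorphisms. -/
instance morMulAction (S T : ObjAction.{v, u, v₁} B) : MulAction T.group (Mor S T) where
  smul g p :=
    { hom := (MulAut.conj g).toMonoidHom.comp p.hom
      map := p.map ≫ (T.hom g : T.obj ⟶ T.obj)
      comm := fun h => by
        rw [← Category.assoc, p.comm, Category.assoc, Category.assoc]
        refine congrArg (p.map ≫ ·) ?_
        change T.hom g * T.hom (p.hom h) = T.hom (g * p.hom h * g⁻¹) * T.hom g
        rw [← map_mul, ← map_mul, inv_mul_cancel_right] }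
  one_smul p := Mor.ext (MonoidHom.ext fun h => by
      change 1 * p.hom h * 1⁻¹ = p.hom h
      simp) (by
      change p.map ≫ (T.hom 1 : T.obj ⟶ T.obj) = p.map
      rw [map_one]; exact Category.comp_id _)
  mul_smul g g' p := Mor.ext (MonoidHom.ext fun h => by
      change g * g' * p.hom h * (g * g')⁻¹ = g * (g' * p.hom h * g'⁻¹) * g⁻¹
      group) (by
      change p.map ≫ (T.hom (g * g') : T.obj ⟶ T.obj) =
        (p.map ≫ (T.hom g' : T.obj ⟶ T.obj)) ≫ (T.hom g : T.obj ⟶ T.obj)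
      rw [map_mul, Category.assoc]; rfl)

/-- Clearing the inverse from the conjugation gives exactly the conditions by which `homEquiv`
describes 2-morphisms. -/
theorem smul_eq_iff {S T : ObjAction.{v, u, v₁} B} (g : T.group) (p q : Mor S T) :
    g • p = q ↔ (∀ h, g * p.hom h = q.hom h * g) ∧
      p.map ≫ (T.hom g : T.obj ⟶ T.obj) = q.map := by
  rw [Mor.ext_iff, MonoidHom.ext_iff]
  refine and_congr (forall_congr' fun h => ?_) Iff.rfl
  change g * p.hom h * g⁻¹ = _ ↔ _
  exact mul_inv_eq_iff_eq_mul

variable {G : Type u₁} [Groupoid.{v₁} G]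

/-- The action of the automorphism group of `x` on the image of `x` in `B`. -/
def atObj (F : G ⥤ B) (x : G) [Finite (End x)] : ObjAction.{v, u, v₁} B where
  group := End x
  obj := F.obj x
  hom := F.mapEnd x

/-- A morphism of actions to `atObj F x` as a 1-morphism of `RelFin_B`. -/
def Mor.toHom {F : G ⥤ B} {hF : IsRelativelyFinite F} {S : ObjAction.{v, u, v₁} B} {x : G}
    [Finite (End x)] (p : Mor S (atObj F x)) :
    RelFin.ofGroup (SingleObj.functor S.hom) ⟶ RelFin.of F hF :=
  GrpdOver.Hom.mk (X := (RelFin.ofGroup (SingleObj.functor S.hom)).toGrpdOver)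
    (Y := (RelFin.of F hF).toGrpdOver)
    (ULift.downFunctor ⋙ SingleObj.functor (X := x) p.hom)
    (NatIso.ofComponents (fun _ => (Groupoid.isoEquivHom S.obj (F.obj x)).symm p.map)
      fun h => p.comm h)

/-- The 2-morphisms between 1-morphisms out of the delooping of a group. -/
def homEquiv {F : G ⥤ B} {hF : IsRelativelyFinite F} {S : ObjAction.{v, u, v₁} B} {x y : G}
    [Finite (End x)] [Finite (End y)] (p : Mor S (atObj F x)) (q : Mor S (atObj F y)) :
    ((p.toHom : _ ⟶ RelFin.of F hF) ⟶ q.toHom) ≃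
      { k : x ⟶ y // (∀ h : S.group, (p.hom h : x ⟶ x) ≫ k = k ≫ (q.hom h : y ⟶ y)) ∧
        p.map ≫ F.map k = q.map } where
  toFun a := ⟨(GrpdOver.Hom₂.natTrans a).app ⟨SingleObj.star _⟩,
    fun h => (GrpdOver.Hom₂.natTrans a).naturality
      (X := ⟨SingleObj.star _⟩) (Y := ⟨SingleObj.star _⟩) h,
    GrpdOver.hom₂_w_app a ⟨SingleObj.star _⟩⟩
  invFun k := GrpdOver.mkHom₂ (X := (RelFin.ofGroup (SingleObj.functor S.hom)).toGrpdOver)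
    (Y := (RelFin.of F hF).toGrpdOver) p.toHom q.toHom
    { app := fun _ => k.1, naturality := fun _ _ h => k.2.1 h } fun _ => k.2.2
  left_inv _ := GrpdOver.hom₂_ext fun _ => rfl
  right_inv _ := rfl

/-- The morphism of actions given by a group action on an object of `G` isomorphic to `x`. -/
def Mor.ofIso (F : G ⥤ B) {S : ObjAction.{v, u, v₁} B} {x y : G} [Finite (End x)] (k : x ≅ y)
    (φ : S.group → (y ⟶ y)) (φ_one : φ 1 = 𝟙 y) (φ_mul : ∀ a b, φ (a * b) = φ b ≫ φ a)
    (m : S.obj ⟶ F.obj y) (hm : ∀ h, (S.hom h : S.obj ⟶ S.obj) ≫ m = m ≫ F.map (φ h)) :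
    Mor S (atObj F x) where
  hom :=
    { toFun := fun h => (k.hom ≫ φ h ≫ k.inv : x ⟶ x)
      map_one' := by rw [φ_one, Category.id_comp, Iso.hom_inv_id]; rfl
      map_mul' := fun a b => by
        change k.hom ≫ φ (a * b) ≫ k.inv = (k.hom ≫ φ b ≫ k.inv) ≫ (k.hom ≫ φ a ≫ k.inv)
        simp [φ_mul] }
  map := m ≫ F.map k.inv
  comm h := by
    change (S.hom h : S.obj ⟶ S.obj) ≫ m ≫ F.map k.inv =
      (m ≫ F.map k.inv) ≫ F.map (k.hom ≫ φ h ≫ k.inv)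
    rw [← Category.assoc, hm, Category.assoc, Category.assoc, ← F.map_comp, ← F.map_comp,
      Iso.inv_hom_id_assoc]

/-- Every 1-morphism out of the delooping of a group is isomorphic to one with value a prescribed
object in the isomorphism class. -/
theorem exists_toHom_iso {F : G ⥤ B} {hF : IsRelativelyFinite F} {S : ObjAction.{v, u, v₁} B}
    (f : RelFin.ofGroup (SingleObj.functor S.hom) ⟶ RelFin.of F hF) (x : G) [Finite (End x)]
    (k : x ≅ (GrpdOver.Hom.functor f).obj ⟨SingleObj.star _⟩) :
    ∃ p : Mor S (atObj F x), Nonempty (p.toHom ≅ f) := by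
  let p : Mor S (atObj F x) := Mor.ofIso F k
    (fun h => (GrpdOver.Hom.functor f).map (X := ⟨SingleObj.star _⟩) (Y := ⟨SingleObj.star _⟩) h)
    ((GrpdOver.Hom.functor f).map_id ⟨SingleObj.star _⟩)
    (fun a b => (GrpdOver.Hom.functor f).map_comp (X := ⟨SingleObj.star _⟩)
      (Y := ⟨SingleObj.star _⟩) (Z := ⟨SingleObj.star _⟩) b a)
    ((GrpdOver.Hom.iso f).hom.app ⟨SingleObj.star _⟩)
    (fun h => (GrpdOver.Hom.iso f).hom.naturality (X := ⟨SingleObj.star _⟩)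
      (Y := ⟨SingleObj.star _⟩) h)
  have h₁ : ∀ {y : G} (k : x ≅ y) (a : y ⟶ y), (k.hom ≫ a ≫ k.inv) ≫ k.hom = k.hom ≫ a := by
    simp
  have h₂ : ∀ {y : G} (k : x ≅ y) {z : B} (m : z ⟶ F.obj y),
      (m ≫ F.map k.inv) ≫ F.map k.hom = m := by
    intro y k z m
    rw [Category.assoc, ← F.map_comp, Iso.inv_hom_id, F.map_id, Category.comp_id]
  exact ⟨p, ⟨GrpdOver.isoOfHom₂ (GrpdOver.mkHom₂
    (X := (RelFin.ofGroup (SingleObj.functor S.hom)).toGrpdOver)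
    (Y := (RelFin.of F hF).toGrpdOver) p.toHom f
    { app := fun _ => k.hom
      naturality := fun _ _ _ => h₁ k _ } fun _ => h₂ k _)⟩⟩

/-- The groupoid cardinality of the 1-morphisms out of the delooping of a group. -/
theorem groupoidCardinality_eq_mass (F : G ⥤ B) (hF : IsRelativelyFinite F)
    [∀ x : G, Finite (End x)] (S : ObjAction.{v, u, v₁} B) :
    groupoidCardinality (RelFin.ofGroup (SingleObj.functor S.hom) ⟶ RelFin.of F hF) =
      mass (fun c : Quotient (isIsomorphicSetoid G) => atObj F c.out) S := by
  refine groupoidCardinality_eq_tsum_of_actions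
    (A := fun c : Quotient (isIsomorphicSetoid G) => (atObj F c.out).group)
    (P := fun c => Mor S (atObj F c.out)) (fun c p => p.toHom) ?_ ?_ ?_ ?_
  · intro f
    let x := (GrpdOver.Hom.functor f).obj ⟨SingleObj.star _⟩
    obtain ⟨k⟩ : Nonempty ((⟦x⟧ : Quotient (isIsomorphicSetoid G)).out ≅ x) :=
      Quotient.mk_out (s := isIsomorphicSetoid G) x
    exact ⟨⟦x⟧, exists_toHom_iso f _ k⟩
  · rintro c d p q ⟨e⟩
    have k := (homEquiv p q e.hom).1
    rw [← Quotient.out_eq c, ← Quotient.out_eq d]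
    exact Quotient.sound ⟨(Groupoid.isoEquivHom _ _).symm k⟩
  · intro c p q
    constructor
    · rintro ⟨e⟩
      obtain ⟨k, hk⟩ := homEquiv p q e.hom
      exact ⟨k, (smul_eq_iff (T := atObj F c.out) k p q).2 hk⟩
    · rintro ⟨k, hk⟩
      exact ⟨GrpdOver.isoOfHom₂ ((homEquiv p q).symm
        ⟨k, (smul_eq_iff (T := atObj F c.out) k p q).1 hk⟩)⟩
  · intro c p
    exact ⟨((Groupoid.isoEquivHom _ _).trans (homEquiv p p)).trans
      (Equiv.subtypeEquivRight fun k => (smul_eq_iff (T := atObj F c.out) k p p).symm)⟩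

end ObjAction

/-! ### Finiteness -/

section Finiteness

variable {B : Type u} [Groupoid.{v} B] {G : Type u₁} [Groupoid.{v₁} G] {F : G ⥤ B}

/-- The object `x` lies in the full inverse image of `F.obj x`, and a faithful functor embeds its
endomorphisms into a finite hom-set. -/
theorem IsRelativelyFinite.finite_end (hF : IsRelativelyFinite F) (x : G) : Finite (End x) := by
  obtain ⟨D, _, -, hhom, ⟨e⟩⟩ := hF (F.obj x)
  let X : fullInverseImage F (F.obj x) := ⟨x, ⟨Iso.refl _⟩⟩
  have := hhom (e.functor.obj X) (e.functor.obj X)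
  exact Finite.of_injective (fun k : x ⟶ x => e.functor.map (InducedCategory.homMk k : X ⟶ X))
    fun k l h => congrArg InducedCategory.Hom.hom (e.functor.map_injective h)

/-- Isomorphism classes over `y` inject into the objects of the finite groupoid `D`: a fully
faithful functor reflects isomorphism, in particular equality of images. -/
theorem IsRelativelyFinite.isRelFinFamily (hF : IsRelativelyFinite F) [∀ x : G, Finite (End x)] :
    ObjAction.IsRelFinFamily
      fun c : Quotient (isIsomorphicSetoid G) => ObjAction.atObj F c.out := by
  intro y
  obtain ⟨D, _, hD, -, ⟨e⟩⟩ := hF y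
  let X : { c : Quotient (isIsomorphicSetoid G) | Nonempty (F.obj c.out ⟶ y) } →
      fullInverseImage F y := fun c =>
    ⟨c.1.out, c.2.map (Groupoid.isoEquivHom _ _).symm⟩
  refine Set.finite_coe_iff.1 (Finite.of_injective (fun c => e.functor.obj (X c)) fun c d h => ?_)
  let k : X c ≅ X d := e.functor.preimageIso (eqToIso h)
  apply Subtype.ext
  rw [← Quotient.out_eq c.1, ← Quotient.out_eq d.1]
  exact Quotient.sound ⟨(ObjectProperty.ι _).mapIso k⟩

end Finiteness

/-! ### Equivalences of groupoids over `B` -/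

section Components

variable {I : Type*} {A : I → Type*} [∀ i, Group (A i)] {G : Type*} [Groupoid G]

/-- The functor from a disjoint union of deloopings given by group homomorphisms to
endomorphism groups. -/
abbrev componentsFunctor (r : I → G) (φ : ∀ i, A i →* End (r i)) :
    (Σ i, SingleObj (A i)) ⥤ G :=
  Sigma.desc fun i => SingleObj.functor (φ i)

theorem componentsFunctor_isEquivalence (r : I → G) (φ : ∀ i, A i →* End (r i))
    (hr : ∀ i j, Nonempty (r i ≅ r j) → i = j) (hsurj : ∀ x : G, ∃ i, Nonempty (r i ≅ x))
    (hφ : ∀ i, Function.Bijective (φ i)) : (componentsFunctor r φ).IsEquivalence where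
  faithful := ⟨by
    rintro ⟨i, x⟩ ⟨j, y⟩ ⟨f⟩ ⟨g⟩ h
    exact congrArg Sigma.SigmaHom.mk ((hφ i).1 h)⟩
  full := ⟨by
    rintro ⟨i, x⟩ ⟨j, y⟩ k
    obtain rfl := hr i j ⟨(Groupoid.isoEquivHom (r i) (r j)).symm k⟩
    obtain ⟨a, ha⟩ := (hφ i).2 k
    exact ⟨Sigma.SigmaHom.mk (C := fun i => SingleObj (A i)) (X := x) (Y := y) a, ha⟩⟩
  essSurj := ⟨fun x => by
    obtain ⟨i, hi⟩ := hsurj x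
    exact ⟨⟨i, SingleObj.star _⟩, hi⟩⟩

end Components

/-- An equivalence of total groupoids which commutes with the functors to `B` up to isomorphism
is an equivalence in `RelFin_B`. -/
theorem RelFin.nonempty_equivalence {B : Type u} [Groupoid.{v} B] {X Y : RelFin.{v, u, v₁, u₁} B}
    (E : X.carrier ≌ Y.carrier) (η : X.functor ≅ E.functor ⋙ Y.functor) :
    Nonempty (Bicategory.Equivalence X Y) := by
  let f : X.toGrpdOver ⟶ Y.toGrpdOver := ⟨E.functor, η⟩
  -- The 2-cell of the inverse is the only available composite: the inverse counit pushed to `B`,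
  -- followed by `η⁻¹`.
  let g : Y.toGrpdOver ⟶ X.toGrpdOver := ⟨E.inverse,
    NatIso.ofComponents
      (fun y => (Y.functor.mapIso (E.counitIso.app y)).symm ≪≫ (η.app (E.inverse.obj y)).symm)
      (fun {y z} k => by
        have h₁ := η.inv.naturality (E.inverse.map k)
        have h₂ := Y.functor.congr_map (E.counitInv.naturality k)
        simp only [Functor.comp_map, Functor.id_map, Functor.map_comp] at h₁ h₂
        simp only [Iso.trans_hom, Iso.symm_hom, Functor.mapIso_inv, Iso.app_inv, Functor.comp_map,
          Category.assoc]
        erw [reassoc_of% h₂, h₁])⟩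
  let unit : 𝟙 X.toGrpdOver ⟶ f ≫ g := GrpdOver.mkHom₂ _ _ E.unit fun x => by
    rw [GrpdOver.comp_iso_hom_app, GrpdOver.id_iso_hom_app]
    have h := η.hom.naturality (E.unit.app x)
    have h' : E.counitIso.inv.app (E.functor.obj x) = E.functor.map (E.unit.app x) :=
      E.counitInv_app_functor x
    change 𝟙 _ ≫ X.functor.map (E.unit.app x) = η.hom.app x ≫
      Y.functor.map (E.counitIso.inv.app (E.functor.obj x)) ≫
        η.inv.app (E.inverse.obj (E.functor.obj x))
    rw [h', Category.id_comp, ← Category.assoc]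
    exact (Iso.eq_comp_inv (η.app _)).2 h
  let counit : g ≫ f ⟶ 𝟙 Y.toGrpdOver := GrpdOver.mkHom₂ _ _ E.counit fun x => by
    rw [GrpdOver.comp_iso_hom_app, GrpdOver.id_iso_hom_app]
    simp [f, g]
  -- Adjointification supplies the triangle identity, so two invertible 2-cells suffice.
  exact ⟨Bicategory.Equivalence.mkOfAdjointifyCounit (B := RelFin.{v, u, v₁, u₁} B) (f := f)
    (g := g) (GrpdOver.isoOfHom₂ unit) (GrpdOver.isoOfHom₂ counit)⟩

theorem mainTheorem1 {B : Type u} [Groupoid.{v} B] (hB : IsLocallyFiniteGroupoid B)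
    {G G' : Type u₁} [Groupoid.{v₁} G] [Groupoid.{v₁} G'] (F : G ⥤ B) (F' : G' ⥤ B)
    (hF : IsRelativelyFinite F) (hF' : IsRelativelyFinite F')
    (hcard : ∀ (H : Type v₁) [Group H] [Finite H] (S : SingleObj H ⥤ B),
      groupoidCardinality (RelFin.ofGroup S ⟶ RelFin.of F hF) =
        groupoidCardinality (RelFin.ofGroup S ⟶ RelFin.of F' hF')) :
    Nonempty (Bicategory.Equivalence (RelFin.of F hF) (RelFin.of F' hF')) := by
  have := hF.finite_end
  have := hF'.finite_end
  obtain ⟨e, he⟩ := ObjAction.exists_equiv_of_mass_eq hB hF.isRelFinFamily hF'.isRelFinFamily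
    fun S => by
      rw [← ObjAction.groupoidCardinality_eq_mass F hF,
        ← ObjAction.groupoidCardinality_eq_mass F' hF']
      exact hcard S.group (SingleObj.functor S.hom)
  choose p hp using he
  have hout : ∀ {G : Type u₁} [Groupoid.{v₁} G] (c d : Quotient (isIsomorphicSetoid G)),
      Nonempty (c.out ≅ d.out) → c = d := fun c d h => by
    rw [← Quotient.out_eq c, ← Quotient.out_eq d]
    exact Quotient.sound h
  -- `G` and `G'` are both compared with one skeleton, the disjoint union of the deloopings of the
  -- groups `End c.out`: tautologically for `G`, through the matching `e` and the isomorphisms `p`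
  -- for `G'`.
  let K := componentsFunctor (fun c : Quotient (isIsomorphicSetoid G) => c.out)
    fun c => MonoidHom.id (End c.out)
  have hK : K.IsEquivalence := componentsFunctor_isEquivalence _ _ hout
    (fun x => ⟨⟦x⟧, Quotient.mk_out (s := isIsomorphicSetoid G) x⟩)
    fun _ => Function.bijective_id
  let K' := componentsFunctor (A := fun c : Quotient (isIsomorphicSetoid G) => End c.out)
    (fun c => (e c).out) fun c => (p c).hom
  have hK' : K'.IsEquivalence := componentsFunctor_isEquivalence _ _
    (fun c d h => e.injective (hout _ _ h))
    (fun x => ⟨e.symm ⟦x⟧, by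
      rw [e.apply_symm_apply]
      exact Quotient.mk_out (s := isIsomorphicSetoid G') x⟩)
    hp
  -- The object parts of the `p c` are the components, and equivariance is their naturality.
  let θ : K ⋙ F ≅ K' ⋙ F' := Sigma.natIso fun c => NatIso.ofComponents
    (fun _ => (Groupoid.isoEquivHom _ _).symm (p c).map) fun h => (p c).comm h
  refine RelFin.nonempty_equivalence (X := RelFin.of F hF) (Y := RelFin.of F' hF')
    (K.asEquivalence.symm.trans K'.asEquivalence) ?_
  exact (Functor.leftUnitor F).symm ≪≫
    Functor.isoWhiskerRight K.asEquivalence.counitIso.symm F ≪≫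
    Functor.associator _ _ _ ≪≫ Functor.isoWhiskerLeft _ θ ≪≫ (Functor.associator _ _ _).symm
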